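/- Let $I\ge 1$ be the batch size, $\eta>0$ and $\kappa:=I\eta$. Let $L(y,\lambda)$ be a loss function, fix $\lambda$, and assume that $y\mapsto L(y,\lambda)$ is measurable with values in $[0,1]$. Let $B_g=(Y_{g,1},\dots,Y_{g,I})$, $g=1,2,\dots$, be i.i.d. batches (no assumption is made on the dependence within a batch). Let $p_g=(p_{g,1},\dots,p_{g,I})$, $g=1,2,\dots$, be i.i.d. random weight vectors with the symmetric Dirichlet law $\mathrm{Dirichlet}(\eta,\dots,\eta)$ on the simplex, and let the sequence $(p_g)_g$ be independent of the sequence $(B_g)_g$. Put \[ \ell_{g,i}=L(Y_{g,i},\lambda),\qquad \mu_g=\frac1I\sum_{i=1}^I \ell_{g,i},\qquad \mathrm{Var}_{\rm emp}(\ell_g)=\frac1I\sum_{i=1}^I(\ell_{g,i}-\mu_g)^2,\qquad L_g=\sum_{i=1}^I p_{g,i}\,\ell_{g,i},\qquad \bar L_G=\frac1G\sum_{g=1}^G L_g, \] and define (for any $g$; the values do not depend on $g$) \[ \mu(L)=\mathbb E[\mu_g],\qquad \mathrm{Var}(L)=\frac{\mathbb E[\mathrm{Var}_{\rm emp}(\ell_g)]}{\kappa+1}+\mathrm{Var}(\mu_g).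 \] Then $\mu_g$ is square integrable, $\mathrm{Var}_{\rm emp}(\ell_g)$ is integrable, $\mathrm{Var}(L)\ge 0$, and, as $G\to\infty$, \[ \sqrt G\,\bigl(\bar L_G-\mu(L)\bigr)\ \xrightarrow{d}\ \mathcal N\bigl(0,\mathrm{Var}(L)\bigr), \] where $\mathcal N(0,0)$ is the point mass at $0$. -/

import Mathlib

open MeasureTheory ProbabilityTheory Filter

noncomputable section

namespace RBWA

/-- The Dirichlet distribution with parameter vector `α` (all `α i > 0`): the law of
`(X i / ∑ j, X j)_i` for independent `X i ∼ Gamma(α i, 1)`. It is carried by the standard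
simplex, and is the point mass at `1` when there is a single index. -/
def dirichletMeasure {ι : Type*} [Fintype ι] (α : ι → ℝ) : Measure (ι → ℝ) :=
  (Measure.pi fun i => gammaMeasure (α i) 1).map fun x i => x i / ∑ j, x j

/-- The vector `ℓ_g(lam) = (L(Y_{g,1}, lam), …, L(Y_{g,I}, lam))` of losses of a batch `b`. -/
def batchLoss {𝓨 : Type*} {I : ℕ} (L : 𝓨 → ℝ → ℝ) (lam : ℝ) (b : Fin I → 𝓨) : Fin I → ℝ :=
  fun i => L (b i) lam

/-- The within-batch mean `μ_g = (1/I) ∑ i, ℓ_{g,i}`. -/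
def empMean {I : ℕ} (l : Fin I → ℝ) : ℝ := (∑ i, l i) / I

/-- The within-batch empirical variance `(1/I) ∑ i, (ℓ_{g,i} - μ_g)²` (normalized by `1/I`). -/
def empVar {I : ℕ} (l : Fin I → ℝ) : ℝ := (∑ i, (l i - empMean l) ^ 2) / I

/-- The randomized weighted average `L_g = ∑ i, p_{g,i} ℓ_{g,i}` of a batch. -/
def weightedLoss {I : ℕ} (p l : Fin I → ℝ) : ℝ := ∑ i, p i * l i

end RBWA

end

/-!
The weighted losses `L_g = ∑ i, p_{g,i} ℓ_{g,i}` are bounded and i.i.d., so the claim is the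
classical central limit theorem once their mean and variance are identified.

*Independence.* The weights and the losses are each independent over `g`, and the two sequences are
independent of each other. Hence the pairs `(p_g, ℓ_g)` are independent over `g`
(`iIndepFun_prodMk`, a π-system argument on measurable rectangles).

*Moments.* For Dirichlet weights with parameters `α` of sum `κ`,
`E[p_i p_j] = α_i (α_j + 1_{i = j}) / (κ (κ + 1))` (`integral_mul_dirichletMeasure`). To see this
write `p_i = X_i / S` with independent Gamma variables `X_i` of sum `S`, and
`S⁻² = ∫_0^∞ t e^{-tS} dt`. By Tonelli the expectation is an integral over `t` of
`t E[X_i X_j e^{-tS}]`, which factorizes over the coordinates and equals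
`α_i (α_j + 1_{i = j}) · t (1 + t)^{-(κ + 2)}`. The remaining integral over `t` does not depend on
`i` and `j`, so it never has to be computed: it is determined by `∑ i, ∑ j, p_i p_j = 1`. The first
moments `E[p_i] = α_i / κ` follow by summing over `j`.

*Variance.* With `α_i = η` and the losses independent of the weights, expanding the square gives
`E[L_g] = E[μ_g]` and `E[L_g²] = E[μ_g²] + E[Var_emp(ℓ_g)] / (κ + 1)`, so that `Var(L_g)` is the
asserted asymptotic variance (`variance_weightedLoss`).
-/

namespace RBWA

open scoped ENNReal

/-! ### Exponential moments of Gamma variables -/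

section Gamma

lemma ae_pos_gammaMeasure (a r : ℝ) : ∀ᵐ x ∂gammaMeasure a r, 0 < x := by
  rw [gammaMeasure, ae_withDensity_iff (by unfold gammaPDF; fun_prop)]
  filter_upwards [Measure.ae_ne volume (0 : ℝ)] with x hx0 hx
  by_contra! h
  exact hx (gammaPDF_of_neg (lt_of_le_of_ne h hx0))

/-- The moments `E[X ^ n * exp (-(t * X))]` of `X ∼ Gamma(a, 1)`: up to a constant, the integrand
times the density is again a Gamma density, with shape `a + n` and rate `1 + t`. -/
lemma lintegral_pow_mul_exp_gammaMeasure {a t : ℝ} (ha : 0 < a) (ht : 0 ≤ t) (n : ℕ) :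
    ∫⁻ x, ENNReal.ofReal x ^ n * ENNReal.ofReal (Real.exp (-(t * x))) ∂gammaMeasure a 1 =
      ENNReal.ofReal (Real.Gamma (a + n) / Real.Gamma a * (1 + t) ^ (-(a + n))) := by
  have ht1 : 0 < 1 + t := by linarith
  have han : 0 < a + n := by positivity
  have hG := Real.Gamma_pos_of_pos ha
  have hGn := Real.Gamma_pos_of_pos han
  rw [gammaMeasure, lintegral_withDensity_eq_lintegral_mul _ (by unfold gammaPDF; fun_prop)
    (by fun_prop), ← mul_one (ENNReal.ofReal (_ / _ * _)),
    ← lintegral_gammaPDF_eq_one han ht1, ← lintegral_const_mul _ (by unfold gammaPDF; fun_prop)]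
  refine lintegral_congr_ae ?_
  filter_upwards [Measure.ae_ne volume (0 : ℝ)] with x hx0
  rcases lt_or_gt_of_ne hx0 with hx | hx
  · simp [gammaPDF_of_neg hx]
  · rw [Pi.mul_apply, gammaPDF_of_nonneg hx.le, gammaPDF_of_nonneg hx.le,
      ← ENNReal.ofReal_pow hx.le, ← ENNReal.ofReal_mul (by positivity),
      ← ENNReal.ofReal_mul (by positivity), ← ENNReal.ofReal_mul (by positivity)]
    congr 1
    have h1 : x ^ (a + n - 1) = x ^ (a - 1) * x ^ n := by
      rw [← Real.rpow_natCast x n, ← Real.rpow_add hx]; ring_nf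
    have h2 : Real.exp (-((1 + t) * x)) = Real.exp (-(1 * x)) * Real.exp (-(t * x)) := by
      rw [← Real.exp_add]; ring_nf
    have h3 := (Real.rpow_pos_of_pos ht1 (a + n)).ne'
    rw [h1, h2, Real.rpow_neg ht1.le, Real.one_rpow]
    field_simp

/-- The representation `s⁻² = ∫_0^∞ t e^{-ts} dt`. The integral runs over all of `ℝ` since
`ENNReal.ofReal t` vanishes for `t ≤ 0`. -/
lemma lintegral_mul_exp_neg_mul {s : ℝ} (hs : 0 < s) :
    ∫⁻ t, ENNReal.ofReal t * ENNReal.ofReal (Real.exp (-(t * s))) =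
      ENNReal.ofReal (s ^ 2)⁻¹ := by
  have h : ∀ t, ENNReal.ofReal t * ENNReal.ofReal (Real.exp (-(t * s))) =
      ENNReal.ofReal (s ^ 2)⁻¹ * gammaPDF 2 s t := by
    intro t
    rcases lt_or_ge t 0 with ht | ht
    · simp [gammaPDF_of_neg ht, ENNReal.ofReal_of_nonpos ht.le]
    · rw [gammaPDF_of_nonneg ht, ← ENNReal.ofReal_mul ht, ← ENNReal.ofReal_mul (by positivity)]
      congr 1
      norm_num
      field_simp
  simp_rw [h]
  rw [lintegral_const_mul _ (by unfold gammaPDF; fun_prop),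
    lintegral_gammaPDF_eq_one two_pos hs, mul_one]

variable {ι : Type*} [Fintype ι]

lemma ae_pos_pi_gammaMeasure {α : ι → ℝ} (hα : ∀ i, 0 < α i) :
    ∀ᵐ x ∂Measure.pi (fun i => gammaMeasure (α i) 1), ∀ i, 0 < x i := by
  have := fun i => isProbabilityMeasure_gammaMeasure (hα i) one_pos
  rw [ae_all_iff]
  exact fun i => (measurePreserving_eval (fun i => gammaMeasure (α i) 1) i).quasiMeasurePreserving.ae
    (ae_pos_gammaMeasure _ _)

lemma lintegral_pi_prod {β : ι → Type*} [∀ i, MeasurableSpace (β i)] (ν : ∀ i, Measure (β i))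
    [∀ i, IsProbabilityMeasure (ν i)] (f : ∀ i, β i → ℝ≥0∞) (hf : ∀ i, Measurable (f i)) :
    ∫⁻ x, ∏ i, f i (x i) ∂Measure.pi ν = ∏ i, ∫⁻ y, f i y ∂ν i := by
  refine (lintegral_prod_eq_prod_lintegral_of_indepFun Finset.univ (fun i (x : ∀ i, β i) => f i (x i))
    (iIndepFun_pi fun i => (hf i).aemeasurable) (by fun_prop)).trans ?_
  exact Finset.prod_congr rfl fun i _ => (measurePreserving_eval ν i).lintegral_comp (hf i)

variable [DecidableEq ι]

/-- For independent `X k ∼ Gamma(α k, 1)` with sum `S`, the value of `E[X i * X j * exp (-(t * S))]`.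
The dependence on `t` is the same for all `i` and `j`. -/
lemma lintegral_mul_mul_exp_pi_gammaMeasure {α : ι → ℝ} (hα : ∀ i, 0 < α i) {t : ℝ}
    (ht : 0 ≤ t) (i j : ι) :
    ∫⁻ x, ENNReal.ofReal (x i) * ENNReal.ofReal (x j) *
        ENNReal.ofReal (Real.exp (-(t * ∑ k, x k))) ∂Measure.pi (fun i => gammaMeasure (α i) 1) =
      ENNReal.ofReal ((1 + t) ^ (-(∑ k, α k + 2))) *
        ENNReal.ofReal (α i * (α j + if i = j then 1 else 0)) := by
  have := fun i => isProbabilityMeasure_gammaMeasure (hα i) one_pos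
  have ht1 : 0 < 1 + t := by linarith
  -- `n k` is the exponent of `x k` in the monomial `x i * x j`
  set n : ι → ℕ := fun k => (if k = i then 1 else 0) + if k = j then 1 else 0 with hn
  have hprod : ∀ x : ι → ℝ, ENNReal.ofReal (x i) * ENNReal.ofReal (x j) *
        ENNReal.ofReal (Real.exp (-(t * ∑ k, x k))) =
      ∏ k, (ENNReal.ofReal (x k) ^ n k * ENNReal.ofReal (Real.exp (-(t * x k)))) := by
    intro x
    rw [Finset.prod_mul_distrib, Finset.mul_sum, ← Finset.sum_neg_distrib, Real.exp_sum,
      ENNReal.ofReal_prod_of_nonneg fun _ _ => (Real.exp_pos _).le]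
    simp only [hn, pow_add, Finset.prod_mul_distrib]
    simp [pow_ite]
  have hG : ∀ k, 0 < Real.Gamma (α k + n k) / Real.Gamma (α k) := fun k =>
    div_pos (Real.Gamma_pos_of_pos (by have := hα k; positivity)) (Real.Gamma_pos_of_pos (hα k))
  have hG0 : ∀ k, Real.Gamma (α k) ≠ 0 := fun k => (Real.Gamma_pos_of_pos (hα k)).ne'
  simp_rw [hprod]
  rw [lintegral_pi_prod _ (fun k y => ENNReal.ofReal y ^ n k *
    ENNReal.ofReal (Real.exp (-(t * y)))) (by fun_prop)]
  simp_rw [lintegral_pow_mul_exp_gammaMeasure (hα _) ht]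
  rw [← ENNReal.ofReal_prod_of_nonneg fun k _ => mul_nonneg (hG k).le (by positivity),
    Finset.prod_mul_distrib, ← Real.rpow_sum_of_pos ht1, mul_comm, ENNReal.ofReal_mul (by positivity)]
  congr 3
  · simp only [Finset.sum_neg_distrib, Finset.sum_add_distrib, hn, Nat.cast_add]
    simp
    ring
  · by_cases hij : i = j
    · subst hij
      rw [Finset.prod_eq_single_of_mem i (Finset.mem_univ i) fun k _ hk => by simp [hn, hk, hG0]]
      have h2 : α i + (n i : ℕ) = α i + 1 + 1 := by simp [hn]; ring
      rw [h2, Real.Gamma_add_one (by linarith [hα i]), Real.Gamma_add_one (hα i).ne']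
      have := hG0 i
      field_simp
      simp
    · rw [Finset.prod_eq_mul_of_mem i j (Finset.mem_univ i) (Finset.mem_univ j) hij
        fun k _ hk => by simp [hn, hk.1, hk.2, hG0]]
      have := hG0 i
      have := hG0 j
      simp [hn, hij, Ne.symm hij, Real.Gamma_add_one (hα _).ne']
      field_simp

end Gamma

/-! ### Moments of the Dirichlet distribution -/

section Dirichlet

variable {ι : Type*} [Fintype ι]

lemma measurable_div_sum : Measurable fun (x : ι → ℝ) i => x i / ∑ j, x j := by fun_prop

lemma isProbabilityMeasure_dirichletMeasure {α : ι → ℝ} (hα : ∀ i, 0 < α i) :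
    IsProbabilityMeasure (dirichletMeasure α) := by
  have := fun i => isProbabilityMeasure_gammaMeasure (hα i) one_pos
  exact Measure.isProbabilityMeasure_map measurable_div_sum.aemeasurable

lemma ae_mem_stdSimplex_dirichletMeasure [Nonempty ι] {α : ι → ℝ} (hα : ∀ i, 0 < α i) :
    ∀ᵐ x ∂dirichletMeasure α, x ∈ stdSimplex ℝ ι := by
  refine (ae_map_iff measurable_div_sum.aemeasurable
    (isClosed_stdSimplex ℝ ι).measurableSet).2 ?_
  filter_upwards [ae_pos_pi_gammaMeasure hα] with x hx
  have hs : 0 < ∑ j, x j := Finset.sum_pos (fun j _ => hx j) Finset.univ_nonempty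
  refine ⟨fun i => (div_pos (hx i) hs).le, ?_⟩
  rw [← Finset.sum_div, div_self hs.ne']

/-- The second moments of the Dirichlet law, up to a normalizing integral that does not depend on
`i` and `j`. -/
lemma lintegral_mul_dirichletMeasure [DecidableEq ι] {α : ι → ℝ} (hα : ∀ i, 0 < α i) (i j : ι) :
    ∫⁻ x, ENNReal.ofReal (x i * x j) ∂dirichletMeasure α =
      (∫⁻ t, ENNReal.ofReal t * ENNReal.ofReal ((1 + t) ^ (-(∑ k, α k + 2)))) *
        ENNReal.ofReal (α i * (α j + if i = j then 1 else 0)) := by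
  have := fun i => isProbabilityMeasure_gammaMeasure (hα i) one_pos
  rw [dirichletMeasure, lintegral_map (by fun_prop) measurable_div_sum]
  calc ∫⁻ x, ENNReal.ofReal (x i / (∑ k, x k) * (x j / ∑ k, x k))
        ∂Measure.pi (fun i => gammaMeasure (α i) 1)
      = ∫⁻ x, (∫⁻ t, ENNReal.ofReal t * (ENNReal.ofReal (x i) * ENNReal.ofReal (x j) *
          ENNReal.ofReal (Real.exp (-(t * ∑ k, x k)))))
          ∂Measure.pi (fun i => gammaMeasure (α i) 1) := by
        refine lintegral_congr_ae ?_
        filter_upwards [ae_pos_pi_gammaMeasure hα] with x hx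
        have hs : 0 < ∑ j, x j := Finset.sum_pos (fun j _ => hx j) ⟨i, Finset.mem_univ i⟩
        simp_rw [mul_left_comm (ENNReal.ofReal _) (_ * _ : ℝ≥0∞)]
        rw [lintegral_const_mul _ (by fun_prop), lintegral_mul_exp_neg_mul hs,
          ← ENNReal.ofReal_mul (hx i).le, ← ENNReal.ofReal_mul (mul_pos (hx i) (hx j)).le]
        congr 1
        field_simp
    _ = ∫⁻ t, ENNReal.ofReal t * (ENNReal.ofReal ((1 + t) ^ (-(∑ k, α k + 2))) *
          ENNReal.ofReal (α i * (α j + if i = j then 1 else 0))) := by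
        rw [lintegral_lintegral_swap (by fun_prop)]
        refine lintegral_congr fun t => ?_
        rcases lt_or_ge t 0 with ht | ht
        · simp [ENNReal.ofReal_of_nonpos ht.le]
        · rw [lintegral_const_mul _ (by fun_prop), lintegral_mul_mul_exp_pi_gammaMeasure hα ht]
    _ = _ := by
        simp_rw [← mul_assoc]
        rw [lintegral_mul_const _ (by fun_prop)]

/-- The normalizing integral of the second moments is forced by `∑ i, ∑ j, p i * p j = 1` on the
simplex. -/
lemma lintegral_dirichletMeasure_normalization [DecidableEq ι] [Nonempty ι] {α : ι → ℝ}
    (hα : ∀ i, 0 < α i) :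
    (∫⁻ t, ENNReal.ofReal t * ENNReal.ofReal ((1 + t) ^ (-(∑ k, α k + 2)))) =
      ENNReal.ofReal ((∑ k, α k) * (∑ k, α k + 1))⁻¹ := by
  have := isProbabilityMeasure_dirichletMeasure hα
  have hκ : 0 < ∑ k, α k := Finset.sum_pos (fun k _ => hα k) Finset.univ_nonempty
  have hw : ∀ i j, 0 ≤ α i * (α j + if i = j then 1 else 0) := fun i j => by
    have := hα i; have := hα j; positivity
  -- the second moments sum to one because the coordinates do, almost surely
  have hone : ∑ i, ∑ j, ∫⁻ x, ENNReal.ofReal (x i * x j) ∂dirichletMeasure α = 1 := by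
    have hm : ∀ i j, Measurable fun x : ι → ℝ => ENNReal.ofReal (x i * x j) := by fun_prop
    simp_rw [← lintegral_finsetSum Finset.univ fun j _ => hm _ j]
    rw [← lintegral_finsetSum _ (fun i _ => Finset.measurable_sum _ fun j _ => hm i j)]
    rw [← measure_univ (μ := dirichletMeasure α), ← lintegral_one]
    refine lintegral_congr_ae ?_
    filter_upwards [ae_mem_stdSimplex_dirichletMeasure hα] with x hx
    simp_rw [← ENNReal.ofReal_sum_of_nonneg fun j _ => mul_nonneg (hx.1 _) (hx.1 j)]
    rw [← ENNReal.ofReal_sum_of_nonneg fun i _ =>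
      Finset.sum_nonneg fun j _ => mul_nonneg (hx.1 i) (hx.1 j), ← Finset.sum_mul_sum, hx.2]
    simp
  simp_rw [lintegral_mul_dirichletMeasure hα, ← Finset.mul_sum,
    ← ENNReal.ofReal_sum_of_nonneg fun j _ => hw _ j] at hone
  rw [← ENNReal.ofReal_sum_of_nonneg fun i _ => Finset.sum_nonneg fun j _ => hw i j] at hone
  have hsum : ∑ i, ∑ j, α i * (α j + if i = j then 1 else 0) =
      (∑ k, α k) * (∑ k, α k + 1) := by
    simp_rw [← Finset.mul_sum, Finset.sum_add_distrib]
    simp [← Finset.sum_mul]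
  rw [hsum] at hone
  rw [ENNReal.ofReal_inv_of_pos (by positivity)]
  exact ENNReal.eq_inv_of_mul_eq_one_left hone

lemma integral_mul_dirichletMeasure [DecidableEq ι] {α : ι → ℝ} (hα : ∀ i, 0 < α i) (i j : ι) :
    ∫ x, x i * x j ∂dirichletMeasure α =
      α i * (α j + if i = j then 1 else 0) / ((∑ k, α k) * (∑ k, α k + 1)) := by
  have : Nonempty ι := ⟨i⟩
  have hκ : 0 < ∑ k, α k := Finset.sum_pos (fun k _ => hα k) Finset.univ_nonempty
  have hw : 0 ≤ α i * (α j + if i = j then 1 else 0) := by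
    have := hα i; have := hα j; positivity
  rw [integral_eq_lintegral_of_nonneg_ae _ (by fun_prop), lintegral_mul_dirichletMeasure hα,
    lintegral_dirichletMeasure_normalization hα, ← ENNReal.ofReal_mul (by positivity),
    ENNReal.toReal_ofReal (by positivity), inv_mul_eq_div]
  filter_upwards [ae_mem_stdSimplex_dirichletMeasure hα] with x hx
  exact mul_nonneg (hx.1 i) (hx.1 j)

lemma integral_eval_dirichletMeasure {α : ι → ℝ} (hα : ∀ i, 0 < α i) (i : ι) :
    ∫ x, x i ∂dirichletMeasure α = α i / ∑ k, α k := by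
  classical
  have : Nonempty ι := ⟨i⟩
  have := isProbabilityMeasure_dirichletMeasure hα
  have hκ : 0 < ∑ k, α k := Finset.sum_pos (fun k _ => hα k) Finset.univ_nonempty
  have hint : ∀ j, Integrable (fun x : ι → ℝ => x i * x j) (dirichletMeasure α) := fun j => by
    refine Integrable.of_bound (by fun_prop) 1 ?_
    filter_upwards [ae_mem_stdSimplex_dirichletMeasure hα] with x hx
    have h := fun k => mem_Icc_of_mem_stdSimplex hx k
    rw [Real.norm_of_nonneg (mul_nonneg (h i).1 (h j).1)]
    exact mul_le_one₀ (h i).2 (h j).1 (h j).2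
  -- `x i = ∑ j, x i * x j` on the simplex
  have hsplit : ∫ x, x i ∂dirichletMeasure α = ∑ j, ∫ x, x i * x j ∂dirichletMeasure α := by
    rw [← integral_finsetSum _ fun j _ => hint j]
    refine integral_congr_ae ?_
    filter_upwards [ae_mem_stdSimplex_dirichletMeasure hα] with x hx
    rw [← Finset.mul_sum, hx.2, mul_one]
  rw [hsplit]
  simp_rw [integral_mul_dirichletMeasure hα]
  rw [← Finset.sum_div, ← Finset.mul_sum, Finset.sum_add_distrib]
  simp
  field_simp

end Dirichlet

/-! ### Independence of pairs -/

section Independence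

lemma measurableSet_cylinder_finset {ι G : Type*} [MeasurableSpace G] (S : Finset ι)
    {D : ι → Set G} (hD : ∀ i, MeasurableSet (D i)) :
    MeasurableSet {x : ι → G | ∀ i ∈ S, x i ∈ D i} := by
  simp only [Set.ofPred_forall]
  exact S.measurableSet_biInter fun i _ => measurable_pi_apply i (hD i)

lemma preimage_cylinder_finset {Ω ι G : Type*} (S : Finset ι) (Z : ι → Ω → G) (D : ι → Set G) :
    (fun ω i => Z i ω) ⁻¹' {x | ∀ i ∈ S, x i ∈ D i} = ⋂ i ∈ S, Z i ⁻¹' D i := by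
  ext ω; simp

lemma ae_eq_mk_pi {Ω ι G : Type*} [Countable ι] [MeasurableSpace Ω] [MeasurableSpace G]
    {P : Measure Ω} {Z : ι → Ω → G} (hZ : ∀ i, AEMeasurable (Z i) P) :
    (fun ω i => Z i ω) =ᵐ[P] fun ω i => (hZ i).mk (Z i) ω := by
  filter_upwards [ae_all_iff.2 fun i => (hZ i).ae_eq_mk] with ω h
  exact funext h

/-- If the `X i` are independent, the `Y i` are independent, and the two families are independent of
each other, then the pairs `(X i, Y i)` are independent. -/
lemma iIndepFun_prodMk_of_measurable {Ω ι E F : Type*} {mΩ : MeasurableSpace Ω}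
    {mE : MeasurableSpace E} {mF : MeasurableSpace F} {P : Measure Ω}
    {X : ι → Ω → E} {Y : ι → Ω → F} (hX : ∀ i, Measurable (X i)) (hY : ∀ i, Measurable (Y i))
    (hXi : iIndepFun X P) (hYi : iIndepFun Y P)
    (hXY : IndepFun (fun ω i => X i ω) (fun ω i => Y i ω) P) :
    iIndepFun (fun i ω => (X i ω, Y i ω)) P := by
  refine iIndepSets.iIndep (fun i => ((hX i).prodMk (hY i)).comap_le)
    (fun i => {u | ∃ v ∈ Set.image2 (· ×ˢ ·) {s : Set E | MeasurableSet s}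
      {t : Set F | MeasurableSet t}, (fun ω => (X i ω, Y i ω)) ⁻¹' v = u})
    (fun i => isPiSystem_prod.comap _) (fun i => ?_) ?_
  · rw [← generateFrom_prod, MeasurableSpace.comap_generateFrom]
    rfl
  rw [iIndepSets_iff]
  intro S f hf
  -- each `f i` with `i ∈ S` is a preimage of a rectangle `A i ×ˢ B i`
  have hf' : ∀ i, ∃ (A : Set E) (B : Set F), MeasurableSet A ∧ MeasurableSet B ∧
      (i ∈ S → f i = X i ⁻¹' A ∩ Y i ⁻¹' B) := by
    intro i
    by_cases hi : i ∈ S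
    · obtain ⟨_, ⟨A, hA, B, hB, rfl⟩, h⟩ := hf i hi
      exact ⟨A, B, hA, hB, fun _ => h.symm⟩
    · exact ⟨∅, ∅, .empty, .empty, fun h => absurd h hi⟩
  choose A B hA hB hAB using hf'
  have hpair : ∀ i, P (X i ⁻¹' A i ∩ Y i ⁻¹' B i) = P (X i ⁻¹' A i) * P (Y i ⁻¹' B i) := fun i =>
    (hXY.comp (measurable_pi_apply i) (measurable_pi_apply i)).measure_inter_preimage_eq_mul
      _ _ (hA i) (hB i)
  have hall := hXY.measure_inter_preimage_eq_mul _ _ (measurableSet_cylinder_finset S hA)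
    (measurableSet_cylinder_finset S hB)
  rw [preimage_cylinder_finset, preimage_cylinder_finset,
    hXi.measure_inter_preimage_eq_mul S fun i _ => hA i,
    hYi.measure_inter_preimage_eq_mul S fun i _ => hB i, ← Finset.prod_mul_distrib] at hall
  rw [Finset.prod_congr rfl fun i hi => by rw [hAB i hi, hpair i], ← hall]
  congr 1
  ext ω
  simp only [Set.mem_iInter, Set.mem_inter_iff]
  exact ⟨fun h => ⟨fun i hi => ((hAB i hi) ▸ h i hi).1, fun i hi => ((hAB i hi) ▸ h i hi).2⟩,
    fun h i hi => (hAB i hi) ▸ ⟨h.1 i hi, h.2 i hi⟩⟩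

/-- The almost-everywhere measurable version of `iIndepFun_prodMk_of_measurable`. -/
lemma iIndepFun_prodMk {Ω ι E F : Type*} [Countable ι] {mΩ : MeasurableSpace Ω}
    {mE : MeasurableSpace E} {mF : MeasurableSpace F} {P : Measure Ω}
    {X : ι → Ω → E} {Y : ι → Ω → F} (hX : ∀ i, AEMeasurable (X i) P)
    (hY : ∀ i, AEMeasurable (Y i) P) (hXi : iIndepFun X P) (hYi : iIndepFun Y P)
    (hXY : IndepFun (fun ω i => X i ω) (fun ω i => Y i ω) P) :
    iIndepFun (fun i ω => (X i ω, Y i ω)) P := by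
  refine (iIndepFun_prodMk_of_measurable (fun i => (hX i).measurable_mk)
    (fun i => (hY i).measurable_mk) (hXi.congr fun i => (hX i).ae_eq_mk)
    (hYi.congr fun i => (hY i).ae_eq_mk) (hXY.congr (ae_eq_mk_pi hX) (ae_eq_mk_pi hY))).congr
    fun i => ?_
  exact ((hX i).ae_eq_mk.prodMk (hY i).ae_eq_mk).symm

end Independence

/-! ### Empirical mean and variance of a loss vector -/

lemma measurable_empMean {I : ℕ} : Measurable (empMean (I := I)) := by
  unfold empMean; fun_prop

lemma measurable_empVar {I : ℕ} : Measurable (empVar (I := I)) := by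
  have := measurable_empMean (I := I)
  unfold empVar; fun_prop

lemma empVar_nonneg {I : ℕ} (l : Fin I → ℝ) : 0 ≤ empVar l := by
  unfold empVar; positivity

lemma empMean_mem_Icc {I : ℕ} {l : Fin I → ℝ} (hl : ∀ i, l i ∈ Set.Icc (0 : ℝ) 1) :
    empMean l ∈ Set.Icc (0 : ℝ) 1 := by
  have h : ∑ i, l i ≤ I := by
    simpa using Finset.sum_le_sum fun i (_ : i ∈ Finset.univ) => (hl i).2
  exact ⟨div_nonneg (Finset.sum_nonneg fun i _ => (hl i).1) (Nat.cast_nonneg _),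
    div_le_one_of_le₀ h (Nat.cast_nonneg _)⟩

lemma empVar_le_one {I : ℕ} {l : Fin I → ℝ} (hl : ∀ i, l i ∈ Set.Icc (0 : ℝ) 1) :
    empVar l ≤ 1 := by
  have hm := empMean_mem_Icc hl
  refine div_le_one_of_le₀ ?_ (Nat.cast_nonneg _)
  calc ∑ i, (l i - empMean l) ^ 2 ≤ ∑ _i : Fin I, (1 : ℝ) := Finset.sum_le_sum fun i _ => by
        rw [sq_le_one_iff_abs_le_one, abs_le]
        constructor <;> linarith [(hl i).1, (hl i).2, hm.1, hm.2]
    _ = I := by simp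

lemma empVar_eq_sub_sq {I : ℕ} (hI : 0 < I) (l : Fin I → ℝ) :
    empVar l = (∑ i, l i ^ 2) / I - empMean l ^ 2 := by
  have hI' : (I : ℝ) ≠ 0 := by positivity
  simp only [empVar, sub_sq, Finset.sum_add_distrib, Finset.sum_sub_distrib, ← Finset.sum_mul,
    ← Finset.mul_sum]
  have h : ∑ i, l i = I * empMean l := by rw [empMean]; field_simp
  rw [h]
  simp
  field_simp
  ring

/-- The quadratic form of the second moments of `Dirichlet(η, …, η)`, evaluated at a fixed loss
vector, in terms of its empirical mean and variance. -/
lemma sum_mul_mul_eq_empMean_sq_add {I : ℕ} (hI : 0 < I) {η : ℝ} (hη : 0 < η) (l : Fin I → ℝ) :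
    ∑ i, ∑ j, η * (η + if i = j then 1 else 0) / (I * η * (I * η + 1)) * (l i * l j) =
      empMean l ^ 2 + empVar l / (I * η + 1) := by
  have hI' : (0 : ℝ) < I := by positivity
  have h : ∑ i, ∑ j, η * (η + if i = j then 1 else 0) / (I * η * (I * η + 1)) * (l i * l j) =
      (η * (∑ i, l i) ^ 2 + ∑ i, l i ^ 2) / (I * (I * η + 1)) := by
    have e : ∀ i j, η * (η + if i = j then 1 else 0) / (I * η * (I * η + 1)) * (l i * l j) =
        (η * (l i * l j) + if i = j then l i * l j else 0) / (I * (I * η + 1)) := by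
      intro i j
      split_ifs
      · field_simp
      · field_simp
        ring
    simp_rw [e, ← Finset.sum_div, Finset.sum_add_distrib, ← Finset.mul_sum, sq, Finset.sum_mul_sum]
    simp [← Finset.mul_sum]
  rw [h, empVar_eq_sub_sq hI, empMean]
  field_simp
  ring

/-! ### Moments of the weighted loss -/

section Moments

variable {Ω : Type*} [MeasurableSpace Ω] {P : Measure Ω} [IsProbabilityMeasure P] {I : ℕ}
  {p l : Ω → Fin I → ℝ}

lemma measurable_weightedLoss :
    Measurable fun x : (Fin I → ℝ) × (Fin I → ℝ) => weightedLoss x.1 x.2 := by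
  unfold weightedLoss; fun_prop

lemma memLp_empMean (hl : AEMeasurable l P) (hl01 : ∀ ω i, l ω i ∈ Set.Icc (0 : ℝ) 1) :
    MemLp (fun ω => empMean (l ω)) 2 P :=
  MemLp.of_bound (measurable_empMean.comp_aemeasurable hl).aestronglyMeasurable 1
    (ae_of_all _ fun ω => by
      have := empMean_mem_Icc (hl01 ω)
      rw [Real.norm_of_nonneg this.1]; exact this.2)

lemma integrable_empVar (hl : AEMeasurable l P) (hl01 : ∀ ω i, l ω i ∈ Set.Icc (0 : ℝ) 1) :
    Integrable (fun ω => empVar (l ω)) P :=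
  Integrable.of_bound (measurable_empVar.comp_aemeasurable hl).aestronglyMeasurable 1
    (ae_of_all _ fun ω => by
      rw [Real.norm_of_nonneg (empVar_nonneg _)]; exact empVar_le_one (hl01 ω))

lemma memLp_weightedLoss (hp : AEMeasurable p P) (hl : AEMeasurable l P)
    (hps : ∀ᵐ ω ∂P, p ω ∈ stdSimplex ℝ (Fin I)) (hl01 : ∀ ω i, l ω i ∈ Set.Icc (0 : ℝ) 1) :
    MemLp (fun ω => weightedLoss (p ω) (l ω)) 2 P := by
  refine MemLp.of_bound
    (measurable_weightedLoss.comp_aemeasurable (hp.prodMk hl)).aestronglyMeasurable 1 ?_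
  filter_upwards [hps] with ω hω
  rw [weightedLoss, Real.norm_of_nonneg
    (Finset.sum_nonneg fun i _ => mul_nonneg (hω.1 i) (hl01 ω i).1), ← hω.2]
  exact Finset.sum_le_sum fun i _ => mul_le_of_le_one_right (hω.1 i) (hl01 ω i).2

lemma integral_weightedLoss {η : ℝ} (hI : 0 < I) (hη : 0 < η)
    (hp : HasLaw p (dirichletMeasure fun _ : Fin I => η) P) (hl : AEMeasurable l P)
    (hps : ∀ᵐ ω ∂P, p ω ∈ stdSimplex ℝ (Fin I))
    (hl01 : ∀ ω i, l ω i ∈ Set.Icc (0 : ℝ) 1) (hpl : IndepFun p l P) :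
    ∫ ω, weightedLoss (p ω) (l ω) ∂P = ∫ ω, empMean (l ω) ∂P := by
  have hpm := hp.aemeasurable
  have hint : ∀ i, Integrable (fun ω => p ω i * l ω i) P := fun i => by
    refine Integrable.of_bound (by fun_prop) 1 ?_
    filter_upwards [hps] with ω hω
    have h := mem_Icc_of_mem_stdSimplex hω i
    rw [Real.norm_of_nonneg (mul_nonneg h.1 (hl01 ω i).1)]
    exact mul_le_one₀ h.2 (hl01 ω i).1 (hl01 ω i).2
  have hlint : ∀ i, Integrable (fun ω => l ω i) P := fun i =>
    Integrable.of_bound (by fun_prop) 1 (ae_of_all _ fun ω => by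
      rw [Real.norm_of_nonneg (hl01 ω i).1]; exact (hl01 ω i).2)
  have hmean : ∀ i, ∫ ω, p ω i ∂P = (I : ℝ)⁻¹ := fun i => by
    rw [← integral_map hpm (f := fun x : Fin I → ℝ => x i)
      (measurable_pi_apply i).aestronglyMeasurable, hp.map_eq,
      integral_eval_dirichletMeasure fun _ => hη]
    simp
    field_simp
  simp only [weightedLoss, empMean]
  rw [integral_finsetSum _ fun i _ => hint i, integral_div,
    integral_finsetSum _ fun i _ => hlint i, Finset.sum_div]
  refine Finset.sum_congr rfl fun i _ => ?_
  rw [← inv_mul_eq_div, ← hmean i]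
  exact (hpl.comp (measurable_pi_apply i)
    (measurable_pi_apply i)).integral_fun_mul_eq_mul_integral
    (by simp only [Function.comp_def]; fun_prop) (by simp only [Function.comp_def]; fun_prop)

lemma integral_weightedLoss_sq {η : ℝ} (hI : 0 < I) (hη : 0 < η)
    (hp : HasLaw p (dirichletMeasure fun _ : Fin I => η) P) (hl : AEMeasurable l P)
    (hps : ∀ᵐ ω ∂P, p ω ∈ stdSimplex ℝ (Fin I))
    (hl01 : ∀ ω i, l ω i ∈ Set.Icc (0 : ℝ) 1) (hpl : IndepFun p l P) :
    ∫ ω, weightedLoss (p ω) (l ω) ^ 2 ∂P =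
      ∫ ω, empMean (l ω) ^ 2 ∂P + (∫ ω, empVar (l ω) ∂P) / (I * η + 1) := by
  have hpm := hp.aemeasurable
  have hlint : ∀ i j, Integrable (fun ω => l ω i * l ω j) P := fun i j =>
    Integrable.of_bound (by fun_prop) 1 (ae_of_all _ fun ω => by
      rw [Real.norm_of_nonneg (mul_nonneg (hl01 ω i).1 (hl01 ω j).1)]
      exact mul_le_one₀ (hl01 ω i).2 (hl01 ω j).1 (hl01 ω j).2)
  have hint : ∀ i j, Integrable (fun ω => (p ω i * p ω j) * (l ω i * l ω j)) P := fun i j => by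
    refine (hlint i j).bdd_mul (c := 1) (by fun_prop) ?_
    filter_upwards [hps] with ω hω
    have h := mem_Icc_of_mem_stdSimplex hω
    rw [Real.norm_of_nonneg (mul_nonneg (h i).1 (h j).1)]
    exact mul_le_one₀ (h i).2 (h j).1 (h j).2
  have hsecond : ∀ i j, ∫ ω, p ω i * p ω j ∂P =
      η * (η + if i = j then 1 else 0) / (I * η * (I * η + 1)) := fun i j => by
    rw [← integral_map hpm (f := fun x : Fin I → ℝ => x i * x j) (by fun_prop), hp.map_eq,
      integral_mul_dirichletMeasure fun _ => hη]
    simp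
  have hm : ∀ i j, Measurable fun x : Fin I → ℝ => x i * x j := by fun_prop
  have hfactor : ∀ i j, ∫ ω, (p ω i * p ω j) * (l ω i * l ω j) ∂P =
      ∫ ω, η * (η + if i = j then 1 else 0) / (I * η * (I * η + 1)) * (l ω i * l ω j) ∂P := by
    intro i j
    rw [integral_const_mul, ← hsecond]
    exact (hpl.comp (hm i j) (hm i j)).integral_fun_mul_eq_mul_integral
      (by simp only [Function.comp_def]; fun_prop) (by simp only [Function.comp_def]; fun_prop)
  calc ∫ ω, weightedLoss (p ω) (l ω) ^ 2 ∂P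
      = ∫ ω, ∑ i, ∑ j, (p ω i * p ω j) * (l ω i * l ω j) ∂P := by
        refine integral_congr_ae (ae_of_all _ fun ω => ?_)
        simp only [weightedLoss, sq, Finset.sum_mul_sum]
        exact Finset.sum_congr rfl fun i _ => Finset.sum_congr rfl fun j _ => by ring
    _ = ∫ ω, (empMean (l ω) ^ 2 + empVar (l ω) / (I * η + 1)) ∂P := by
        simp_rw [← sum_mul_mul_eq_empMean_sq_add hI hη]
        rw [integral_finsetSum _ fun i _ => integrable_finsetSum _ fun j _ => hint i j,
          integral_finsetSum _ fun i _ => integrable_finsetSum _ fun j _ =>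
            (hlint i j).const_mul _]
        refine Finset.sum_congr rfl fun i _ => ?_
        rw [integral_finsetSum _ fun j _ => hint i j,
          integral_finsetSum _ fun j _ => (hlint i j).const_mul _]
        exact Finset.sum_congr rfl fun j _ => hfactor i j
    _ = _ := by
        rw [integral_add (memLp_empMean hl hl01).integrable_sq
          ((integrable_empVar hl hl01).div_const _), integral_div]

lemma variance_weightedLoss {η : ℝ} (hI : 0 < I) (hη : 0 < η)
    (hp : HasLaw p (dirichletMeasure fun _ : Fin I => η) P) (hl : AEMeasurable l P)
    (hps : ∀ᵐ ω ∂P, p ω ∈ stdSimplex ℝ (Fin I))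
    (hl01 : ∀ ω i, l ω i ∈ Set.Icc (0 : ℝ) 1) (hpl : IndepFun p l P) :
    Var[fun ω => weightedLoss (p ω) (l ω); P] =
      (∫ ω, empVar (l ω) ∂P) / (I * η + 1) + Var[fun ω => empMean (l ω); P] := by
  rw [variance_eq_sub (memLp_weightedLoss hp.aemeasurable hl hps hl01),
    variance_eq_sub (memLp_empMean hl hl01)]
  simp only [Pi.pow_apply]
  rw [integral_weightedLoss hI hη hp hl hps hl01 hpl,
    integral_weightedLoss_sq hI hη hp hl hps hl01 hpl]
  ring

end Moments

end RBWA

theorem mainTheorem5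
    {Ω 𝓨 : Type*} [MeasurableSpace Ω] [MeasurableSpace 𝓨]
    (P : Measure Ω) [IsProbabilityMeasure P]
    (I : ℕ) (hI : 0 < I) (η : ℝ) (hη : 0 < η)
    -- the loss at the fixed parameter `lam`
    (L : 𝓨 → ℝ → ℝ) (lam : ℝ)
    (hLmeas : Measurable fun y => L y lam)
    (hLbdd : ∀ y, L y lam ∈ Set.Icc (0 : ℝ) 1)
    -- i.i.d. batches `Y g = (Y_{g,1}, …, Y_{g,I})`
    (Y : ℕ → Ω → Fin I → 𝓨)
    (hYindep : iIndepFun Y P)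
    (hYident : ∀ g, IdentDistrib (Y g) (Y 0) P P)
    -- i.i.d. symmetric Dirichlet weights, independent of the batches
    (p : ℕ → Ω → Fin I → ℝ)
    (hplaw : ∀ g, HasLaw (p g) (RBWA.dirichletMeasure fun _ : Fin I => η) P)
    (hpindep : iIndepFun p P)
    (hpY : IndepFun (fun ω g => p g ω) (fun ω g => Y g ω) P)
    -- the batch losses `ℓ_g`, the batch means `μ_g`, the weighted averages `L_g`
    (l : ℕ → Ω → Fin I → ℝ) (hl : ∀ g ω, l g ω = RBWA.batchLoss L lam (Y g ω))
    (μ : ℕ → Ω → ℝ) (hμ : ∀ g ω, μ g ω = RBWA.empMean (l g ω))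
    (Lg : ℕ → Ω → ℝ) (hLg : ∀ g ω, Lg g ω = RBWA.weightedLoss (p g ω) (l g ω))
    -- the precision, and the asymptotic mean and variance (the same for every batch index `g`)
    (κ : ℝ) (hκ : κ = I * η) (g : ℕ) (muL varL : ℝ)
    (hmuL : muL = ∫ ω, μ g ω ∂P)
    (hvarL : varL = (∫ ω, RBWA.empVar (l g ω) ∂P) / (κ + 1) + Var[μ g; P]) :
    MemLp (μ g) 2 P ∧ Integrable (fun ω => RBWA.empVar (l g ω)) P ∧ 0 ≤ varL ∧
      TendstoInDistribution
        (fun (G : ℕ) ω => √(G : ℝ) * ((∑ j ∈ Finset.range G, Lg j ω) / G - muL))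
        atTop (id : ℝ → ℝ) (fun _ => P) (gaussianReal 0 varL.toNNReal) := by
  have hBL : Measurable (RBWA.batchLoss (I := I) L lam) :=
    measurable_pi_lambda _ fun i => hLmeas.comp (measurable_pi_apply i)
  have hlY : ∀ g, l g = RBWA.batchLoss L lam ∘ Y g := fun g => funext (hl g)
  have hlid : ∀ g, IdentDistrib (l g) (l 0) P P := fun g => by
    rw [hlY g, hlY 0]; exact (hYident g).comp hBL
  have hlm : ∀ g, AEMeasurable (l g) P := fun g => (hlid g).aemeasurable_fst
  have hl01 : ∀ g ω i, l g ω i ∈ Set.Icc (0 : ℝ) 1 := fun g ω i => by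
    rw [hl]; exact hLbdd _
  have hli : iIndepFun l P := by
    have h := hYindep.comp (fun _ => RBWA.batchLoss L lam) fun _ => hBL
    rwa [show (fun g => RBWA.batchLoss L lam ∘ Y g) = l from funext fun g => (hlY g).symm] at h
  have hpl : IndepFun (fun ω g => p g ω) (fun ω g => l g ω) P := by
    have h := hpY.comp (φ := id) (ψ := fun y g => RBWA.batchLoss L lam (y g)) measurable_id
      (by fun_prop)
    rwa [show (fun y g => RBWA.batchLoss L lam (y g)) ∘ (fun ω g => Y g ω) = fun ω g => l g ω from
      funext fun ω => funext fun g => (hl g ω).symm] at h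
  have hplg : ∀ g, IndepFun (p g) (l g) P := fun g =>
    hpl.comp (measurable_pi_apply g) (measurable_pi_apply g)
  have hpm : ∀ g, AEMeasurable (p g) P := fun g => (hplaw g).aemeasurable
  have : Nonempty (Fin I) := ⟨⟨0, hI⟩⟩
  have hps : ∀ g, ∀ᵐ ω ∂P, p g ω ∈ stdSimplex ℝ (Fin I) := fun g =>
    ae_of_ae_map (hpm g) ((hplaw g).map_eq ▸ RBWA.ae_mem_stdSimplex_dirichletMeasure fun _ => hη)
  have hμfun : ∀ g, μ g = fun ω => RBWA.empMean (l g ω) := fun g => funext (hμ g)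
  have hLfun : ∀ g, Lg g = fun ω => RBWA.weightedLoss (p g ω) (l g ω) := fun g => funext (hLg g)
  have hWi : iIndepFun Lg P := by
    have h := (RBWA.iIndepFun_prodMk hpm hlm hpindep hli hpl).comp
      (fun _ x => RBWA.weightedLoss x.1 x.2) fun _ => RBWA.measurable_weightedLoss
    convert h using 1
    exact funext hLfun
  have hWid : ∀ g, IdentDistrib (Lg g) (Lg 0) P P := fun g => by
    have hpid : IdentDistrib (p g) (p 0) P P :=
      ⟨hpm g, hpm 0, (hplaw g).map_eq.trans (hplaw 0).map_eq.symm⟩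
    rw [hLfun g, hLfun 0]
    exact (hpid.prodMk (hlid g) (hplg g) (hplg 0)).comp RBWA.measurable_weightedLoss
  have hWL2 : MemLp (Lg 0) 2 P := by
    rw [hLfun]; exact RBWA.memLp_weightedLoss (hpm 0) (hlm 0) (hps 0) (hl01 0)
  have hmean : P[Lg 0] = muL := by
    rw [← (hWid g).integral_eq, hmuL, hLfun, hμfun]
    exact RBWA.integral_weightedLoss hI hη (hplaw g) (hlm g) (hps g) (hl01 g) (hplg g)
  have hvar : Var[Lg 0; P] = varL := by
    rw [← (hWid g).variance_eq, hvarL, hκ, hLfun, hμfun]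
    exact RBWA.variance_weightedLoss hI hη (hplaw g) (hlm g) (hps g) (hl01 g) (hplg g)
  refine ⟨?_, RBWA.integrable_empVar (hlm g) (hl01 g), hvar ▸ variance_nonneg _ _, ?_⟩
  · rw [hμfun]; exact RBWA.memLp_empMean (hlm g) (hl01 g)
  have hclt := tendstoInDistribution_inv_sqrt_mul_sum_sub (Y := (id : ℝ → ℝ))
    (P' := gaussianReal 0 Var[Lg 0; P].toNNReal) HasLaw.id hWL2 hWi hWid
  rw [hvar, hmean] at hclt
  convert hclt using 3 with G ω
  -- for `G = 0` both sides vanish; otherwise they agree by `G = √G * √G`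
  rcases G.eq_zero_or_pos with rfl | hG
  · simp
  · have hG' : (0 : ℝ) < G := by positivity
    have hs : (0 : ℝ) < √G := by positivity
    have hsq : √(G : ℝ) ^ 2 = G := Real.sq_sqrt hG'.le
    field_simp
    rw [hsq]
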